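/- For $d\ge 3$ let $\mathbb S^{d-1}$ be the Euclidean unit sphere of $\mathbb R^d$ with its surface measure $\sigma$, let $B$ be the closed Euclidean unit ball of $\mathbb R^d$ with Lebesgue measure $|B|$, and for $\xi\in\mathbb R^d$ put $$\mu(\xi)=\frac1{\sigma(\mathbb S^{d-1})}\int_{\mathbb S^{d-1}}e^{-2\pi i x\cdot\xi}\,d\sigma(x),\qquad m(\xi)=\frac1{|B|}\int_B e^{-2\pi i x\cdot\xi}\,dx,\qquad g(\xi)=e^{-2\pi^2|\xi|^2/d}.$$ There is an absolute constant $C>0$ such that, for all integers $d\ge 3$ and all $\xi\in\mathbb R^d$, $$|m(\xi)-\mu(\xi)|\le C\,d^{-1}.$$ Furthermore, for each real $\alpha>0$ there is a constant $C(\alpha)>0$, depending only on $\alpha$, such that, for all integers $d\ge 3$ and all $\xi\in\mathbb R^d$, $$|g(\xi)-\mu(\xi)|\le C(\alpha)\,d^{-1/4+\alpha}.$$ -/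

import Mathlib

open MeasureTheory

noncomputable section

namespace MaximalMultipliers

/-- The surface measure `σ` on the Euclidean unit sphere `𝕊^{d-1}` of `ℝ^d`. -/
def surfaceMeasure (d : ℕ) :
    Measure (Metric.sphere (0 : EuclideanSpace ℝ (Fin d)) 1) :=
  (volume : Measure (EuclideanSpace ℝ (Fin d))).toSphere

/-- The spherical multiplier
`μ(ξ) = σ(𝕊^{d-1})⁻¹ ∫_{𝕊^{d-1}} e^{-2πi x·ξ} dσ(x)`. -/
def sphereMultiplier (d : ℕ) (ξ : EuclideanSpace ℝ (Fin d)) : ℂ :=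
  (1 / ((surfaceMeasure d).real Set.univ : ℂ)) *
    ∫ x : Metric.sphere (0 : EuclideanSpace ℝ (Fin d)) 1,
      Complex.exp (-2 * Real.pi * Complex.I * (inner ℝ (x : EuclideanSpace ℝ (Fin d)) ξ : ℝ))
        ∂(surfaceMeasure d)

/-- The ball multiplier `m(ξ) = |B|⁻¹ ∫_B e^{-2πi x·ξ} dx`, with `B` the closed Euclidean unit
ball of `ℝ^d`. -/
def ballMultiplier (d : ℕ) (ξ : EuclideanSpace ℝ (Fin d)) : ℂ :=
  (1 / ((volume : Measure (EuclideanSpace ℝ (Fin d))).real (Metric.closedBall 0 1) : ℂ)) *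
    ∫ x in Metric.closedBall (0 : EuclideanSpace ℝ (Fin d)) 1,
      Complex.exp (-2 * Real.pi * Complex.I * (inner ℝ x ξ : ℝ))

/-- The rescaled Gaussian multiplier `g(ξ) = e^{-2π²|ξ|²/d}`. -/
def gaussMultiplier (d : ℕ) (ξ : EuclideanSpace ℝ (Fin d)) : ℝ :=
  Real.exp (-(2 * Real.pi ^ 2 * ‖ξ‖ ^ 2 / d))

end MaximalMultipliers

end

/-! Write `χ(x) = e^{-2πi x·ξ}`. The divergence theorem for the field `x χ(x)` gives `d ∫_B χ + ∫_B
x·∇χ = ∫_S χ dσ` (`integral_ball_add_eq_integral_sphere`). Since `σ(S) = d |B|`, the difference `m -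
μ` is `-(d |B|)⁻¹ ∫_B x·∇χ`. On chords of `B` parallel to `ξ`, integration by parts bounds the last
integral by `2 |B|`, uniformly in `ξ` (`norm_integral_ball_le`), so `|m - μ| ≤ 2/d`.

The same integral controls `d/dr m(rξ)`. Hence `μ(rξ)` and `μ(ξ)` differ by at most `4/d + 4 |r² -
1|` (`norm_sphereMultiplier_smul_sub_le`). Now `g` is the characteristic function of a Gaussian
vector `X` with covariance `I/d`, so `g(ξ)` is the mean of `μ(|X| ξ)`. As `|X|²` has mean `1` and
variance `2/d`, averaging yields `|g - μ| ≤ 10 d^{-1/2}`, which is stronger than the bound required.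
-/

open MeasureTheory Set Metric Module

namespace MaximalMultipliers

/-! ### Polar coordinates -/

section Polar

variable {E F : Type*} [NormedAddCommGroup E] [NormedSpace ℝ E] [MeasurableSpace E]
  [FiniteDimensional ℝ E] [BorelSpace E]
  [NormedAddCommGroup F]
  (μ : Measure E) [μ.IsAddHaarMeasure]

theorem integrable_polar {f : E → F} (hf : Integrable f μ) :
    Integrable (fun p : sphere (0 : E) 1 × Ioi (0 : ℝ) => f ((p.2 : ℝ) • (p.1 : E)))
      (μ.toSphere.prod (Measure.volumeIoiPow (finrank ℝ E - 1))) := by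
  rw [← μ.measurePreserving_homeomorphUnitSphereProd.integrable_comp_emb
    (Homeomorph.measurableEmbedding _)]
  have h := hf.integrableOn (s := {(0 : E)}ᶜ)
  rw [integrableOn_iff_comap_subtypeVal (by measurability)] at h
  refine h.congr (.of_forall fun x => ?_)
  have hx : ‖(x : E)‖ ≠ 0 := norm_ne_zero_iff.2 x.2
  simp [smul_smul, hx]

variable [NormedSpace ℝ F] [Nontrivial E]

theorem integral_polar (f : E → F) :
    ∫ x, f x ∂μ = ∫ p : sphere (0 : E) 1 × Ioi (0 : ℝ), f ((p.2 : ℝ) • (p.1 : E))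
      ∂(μ.toSphere.prod (Measure.volumeIoiPow (finrank ℝ E - 1))) := by
  rw [← μ.measurePreserving_homeomorphUnitSphereProd.integral_comp
    (Homeomorph.measurableEmbedding _)]
  conv_lhs => rw [← restrict_compl_singleton (μ := μ) 0,
    ← integral_subtype_comap (measurableSet_singleton _).compl]
  congr 1
  ext x
  have hx : ‖(x : E)‖ ≠ 0 := norm_ne_zero_iff.2 x.2
  simp [smul_smul, hx]

theorem integral_volumeIoiPow (n : ℕ) (f : ℝ → F) :
    ∫ r : Ioi (0 : ℝ), f r ∂(Measure.volumeIoiPow n) = ∫ r in Ioi (0 : ℝ), r ^ n • f r := by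
  simp only [Measure.volumeIoiPow, ENNReal.ofReal]
  rw [integral_withDensity_eq_integral_smul,
    integral_subtype_comap measurableSet_Ioi fun a ↦ Real.toNNReal (a ^ n) • f a,
    setIntegral_congr_fun measurableSet_Ioi fun x hx ↦ ?_]
  · rw [NNReal.smul_def, Real.coe_toNNReal _ (pow_nonneg (le_of_lt hx) _)]
  · exact (measurable_subtype_coe.pow_const _).real_toNNReal

theorem integral_eq_integral_sphere_integral_Ioi {f : E → F} (hf : Integrable f μ) :
    ∫ x, f x ∂μ = ∫ θ : sphere (0 : E) 1, ∫ r in Ioi (0 : ℝ),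
      r ^ (finrank ℝ E - 1) • f (r • (θ : E)) ∂volume ∂μ.toSphere := by
  rw [integral_polar, integral_prod _ (integrable_polar μ hf)]
  congr 1
  ext θ
  exact integral_volumeIoiPow _ fun r => f (r • (θ : E))

theorem integral_eq_integral_Ioi_integral_sphere {f : E → F} (hf : Integrable f μ) :
    ∫ x, f x ∂μ = ∫ r in Ioi (0 : ℝ), r ^ (finrank ℝ E - 1) •
      ∫ θ : sphere (0 : E) 1, f (r • (θ : E)) ∂μ.toSphere := by
  rw [integral_polar, integral_prod_symm _ (integrable_polar μ hf)]
  exact integral_volumeIoiPow _ fun r => ∫ θ : sphere (0 : E) 1, f (r • (θ : E)) ∂μ.toSphere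

end Polar

/-! ### Oscillatory integrals over chords and over the ball -/

/-- The character `t ↦ e^{-2πit}`. -/
noncomputable def character (t : ℝ) : ℂ := Complex.exp (-2 * Real.pi * Complex.I * t)

theorem norm_character (t : ℝ) : ‖character t‖ = 1 := by
  have : -2 * (Real.pi : ℂ) * Complex.I * t = ((-2 * Real.pi * t : ℝ) : ℂ) * Complex.I := by
    push_cast; ring
  rw [character, this, Complex.norm_exp_ofReal_mul_I]

theorem continuous_character : Continuous character := by
  unfold character; fun_prop

theorem hasDerivAt_character_mul (s t : ℝ) :
    HasDerivAt (fun t : ℝ => character (t * s))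
      (-2 * Real.pi * Complex.I * s * character (t * s)) t := by
  have h : HasDerivAt (fun t : ℝ => -2 * (Real.pi : ℂ) * Complex.I * ((t * s : ℝ) : ℂ))
      (-2 * Real.pi * Complex.I * s) t := by
    have := ((hasDerivAt_id t).mul_const s).ofReal_comp.const_mul
      (-2 * (Real.pi : ℂ) * Complex.I)
    simpa using this
  simpa [character, mul_comm] using h.cexp

/-- The integrand is `t · d/dt character (t * s)`. Integration by parts leaves boundary terms and `∫
character`, each at most `2 * a`, so the bound is twice the chord length whatever the frequency `s`.
-/
theorem norm_chord_integral_le (s : ℝ) {a : ℝ} (ha : 0 ≤ a) :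
    ‖∫ t in -a..a, (-2 * Real.pi * Complex.I * (t * s : ℝ)) * character (t * s)‖ ≤ 2 * (2 * a) := by
  have hd : ∀ t : ℝ, HasDerivAt (fun t : ℝ => (t : ℂ) * character (t * s))
      (character (t * s) + (-2 * Real.pi * Complex.I * (t * s : ℝ)) * character (t * s)) t := by
    intro t
    convert! (hasDerivAt_id t).ofReal_comp.mul (hasDerivAt_character_mul s t) using 1
    push_cast; simp; ring
  have hc : Continuous fun t : ℝ => character (t * s) := by
    have := continuous_character; fun_prop
  have hi : Continuous fun t : ℝ =>
      (-2 * Real.pi * Complex.I * (t * s : ℝ)) * character (t * s) := by fun_prop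
  have h := intervalIntegral.integral_eq_sub_of_hasDerivAt (a := -a) (b := a)
    (fun t _ => hd t) ((hc.add hi).intervalIntegrable _ _)
  rw [intervalIntegral.integral_add (hc.intervalIntegrable _ _) (hi.intervalIntegrable _ _)] at h
  have h1 : ‖∫ t in -a..a, character (t * s)‖ ≤ 2 * a := by
    refine (intervalIntegral.norm_integral_le_of_norm_le_const (C := 1)
      fun t _ => (norm_character _).le).trans ?_
    rw [abs_of_nonneg (by linarith)]; linarith
  rw [eq_sub_of_add_eq' h]
  refine (norm_sub_le _ _).trans ?_
  refine (add_le_add (norm_sub_le _ _) h1).trans ?_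
  simp [norm_character, abs_of_nonneg ha]; linarith

/-- Fubini over the chords in the direction of coordinate `0`: the chord bound is twice the length,
and the lengths integrate to the volume. -/
theorem norm_integral_ball_coord_le (n : ℕ) (s : ℝ) :
    ‖∫ x in closedBall (0 : EuclideanSpace ℝ (Fin (n + 1))) 1,
      (-2 * Real.pi * Complex.I * (x 0 * s : ℝ)) * character (x 0 * s)‖ ≤
      2 * volume.real (closedBall (0 : EuclideanSpace ℝ (Fin (n + 1))) 1) := by
  set B := closedBall (0 : EuclideanSpace ℝ (Fin (n + 1))) 1
  set e : ℝ × (Fin n → ℝ) ≃ᵐ EuclideanSpace ℝ (Fin (n + 1)) :=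
    (MeasurableEquiv.piFinSuccAbove (fun _ : Fin (n + 1) => ℝ) 0).symm.trans
    (MeasurableEquiv.toLp 2 (Fin (n + 1) → ℝ)) with he
  have hme : MeasurePreserving e :=
    ((volume_preserving_piFinSuccAbove (fun _ : Fin (n + 1) => ℝ) 0).symm _).trans
      (PiLp.volume_preserving_toLp _)
  have he0 : ∀ p, e p 0 = p.1 := fun p => by
    simp [he, MeasurableEquiv.piFinSuccAbove]
  have hnorm : ∀ p, ‖e p‖ ^ 2 = p.1 ^ 2 + ∑ i, p.2 i ^ 2 := fun p => by
    rw [EuclideanSpace.norm_sq_eq, Fin.sum_univ_succ]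
    simp [he, MeasurableEquiv.piFinSuccAbove]
  have hB : ∀ p, e p ∈ B ↔ p.1 ^ 2 + ∑ i, p.2 i ^ 2 ≤ 1 := fun p => by
    rw [mem_closedBall_zero_iff, ← hnorm, sq_le_one_iff₀ (norm_nonneg _)]
  set φ : ℝ → ℂ := fun t => (-2 * Real.pi * Complex.I * (t * s : ℝ)) * character (t * s) with hφ
  have hφc : Continuous φ := by
    have := continuous_character; fun_prop
  have hfin : volume B ≠ ⊤ := measure_closedBall_lt_top.ne
  -- The half-open interval matches interval integrals and costs only an endpoint, hence "almost
  -- every". For a line missing the ball, `Real.sqrt` of a negative number is `0` and `Ioc` is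
  -- empty.
  have slice : ∀ y : Fin n → ℝ, ∃ a : ℝ, 0 ≤ a ∧ ∀ᵐ t : ℝ, (e (t, y) ∈ B ↔ t ∈ Ioc (-a) a) := by
    intro y
    refine ⟨Real.sqrt (1 - ∑ i, y i ^ 2), Real.sqrt_nonneg _, ?_⟩
    set q := 1 - ∑ i, y i ^ 2 with hq
    have hne : ∀ᵐ t : ℝ, t ≠ -Real.sqrt q ∧ t ≠ 0 := by
      filter_upwards [Measure.ae_ne volume (-Real.sqrt q), Measure.ae_ne volume (0 : ℝ)] with t h h'
        using ⟨h, h'⟩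
    filter_upwards [hne] with t ht
    rw [hB]
    simp only [mem_Ioc]
    rcases le_or_gt 0 q with h0 | h0
    · rw [show t ^ 2 + ∑ i, y i ^ 2 ≤ 1 ↔ t ^ 2 ≤ q by rw [hq]; constructor <;> intro h <;> linarith,
        Real.sq_le h0]
      exact and_congr_left fun _ => ⟨fun h => lt_of_le_of_ne h (Ne.symm ht.1), le_of_lt⟩
    · rw [Real.sqrt_eq_zero_of_nonpos h0.le]
      constructor
      · intro h; nlinarith [sq_nonneg t]
      · rintro ⟨h1, h2⟩; linarith
  have hPm : MeasurableSet (e ⁻¹' B) := e.measurable isClosed_closedBall.measurableSet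
  have hPv : volume (e ⁻¹' B) = volume B :=
    hme.measure_preimage isClosed_closedBall.measurableSet.nullMeasurableSet
  have hint : Integrable ((e ⁻¹' B).indicator fun p => φ p.1) := by
    rw [integrable_indicator_iff hPm]
    have hcont : Continuous fun x : EuclideanSpace ℝ (Fin (n + 1)) => φ (x 0) := by fun_prop
    have := (hme.integrableOn_comp_preimage e.measurableEmbedding).2
      (hcont.continuousOn.integrableOn_compact (isCompact_closedBall 0 1))
    simpa [Function.comp_def, he0] using this
  have hint1 : Integrable ((e ⁻¹' B).indicator fun _ => (1 : ℝ)) :=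
    (integrable_indicator_iff hPm).2 (integrableOn_const (by rw [hPv]; exact hfin))
  have key : ∫ x in B, φ (x 0) = ∫ p, (e ⁻¹' B).indicator (fun p => φ p.1) p := by
    rw [integral_indicator hPm, ← hme.setIntegral_preimage_emb e.measurableEmbedding]
    simp only [he0]
  have hvol : volume.real B = ∫ p, (e ⁻¹' B).indicator (fun _ => (1 : ℝ)) p := by
    rw [integral_indicator hPm, setIntegral_const, measureReal_def, measureReal_def, hPv]; simp
  change ‖∫ x in B, φ (x 0)‖ ≤ _
  rw [key, hvol, Measure.volume_eq_prod, integral_prod_symm _ hint, integral_prod_symm _ hint1,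
    ← integral_const_mul]
  refine norm_integral_le_of_norm_le (hint1.integral_prod_right.const_mul 2) (.of_forall fun y => ?_)
  obtain ⟨a, ha, hae⟩ := slice y
  have h1 : ∫ t, (e ⁻¹' B).indicator (fun p => φ p.1) (t, y) = ∫ t in -a..a, φ t := by
    rw [intervalIntegral.integral_of_le (by linarith), ← integral_indicator measurableSet_Ioc]
    refine integral_congr_ae ?_
    filter_upwards [hae] with t ht
    by_cases h : t ∈ Ioc (-a) a
    · exact (indicator_of_mem (s := e ⁻¹' B) (ht.2 h) _).trans (indicator_of_mem h _).symm
    · exact (indicator_of_notMem (s := e ⁻¹' B) (fun h' => h (ht.1 h')) _).trans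
        (indicator_of_notMem h _).symm
  have h2 : ∫ t, (e ⁻¹' B).indicator (fun _ => (1 : ℝ)) (t, y) = 2 * a := by
    have : ∫ t in -a..a, (1 : ℝ) = 2 * a := by simp; ring
    rw [← this, intervalIntegral.integral_of_le (by linarith), ← integral_indicator measurableSet_Ioc]
    refine integral_congr_ae ?_
    filter_upwards [hae] with t ht
    by_cases h : t ∈ Ioc (-a) a
    · exact (indicator_of_mem (s := e ⁻¹' B) (ht.2 h) _).trans (indicator_of_mem h fun _ => (1 : ℝ)).symm
    · exact (indicator_of_notMem (s := e ⁻¹' B) (fun h' => h (ht.1 h')) _).trans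
        (indicator_of_notMem h _).symm
  rw [h1, h2]
  exact norm_chord_integral_le s ha

/-- By rotation invariance of the ball and of Lebesgue measure, `ξ` may be taken along the first
basis vector. -/
theorem norm_integral_ball_le {d : ℕ} (hd : 1 ≤ d) (ξ : EuclideanSpace ℝ (Fin d)) :
    ‖∫ x in closedBall (0 : EuclideanSpace ℝ (Fin d)) 1,
      (-2 * Real.pi * Complex.I * (inner ℝ x ξ : ℝ)) * character (inner ℝ x ξ)‖ ≤
      2 * volume.real (closedBall (0 : EuclideanSpace ℝ (Fin d)) 1) := by
  obtain ⟨n, rfl⟩ : ∃ n, d = n + 1 := ⟨d - 1, by omega⟩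
  obtain ⟨b, hb⟩ : ∃ b : OrthonormalBasis (Fin (n + 1)) ℝ (EuclideanSpace ℝ (Fin (n + 1))),
      ξ = ‖ξ‖ • b 0 := by
    rcases eq_or_ne ξ 0 with rfl | h0
    · exact ⟨EuclideanSpace.basisFun _ _, by simp⟩
    · have hv : Orthonormal ℝ (({0} : Set (Fin (n + 1))).domRestrict
          fun _ => (‖ξ‖⁻¹ • ξ : EuclideanSpace ℝ (Fin (n + 1)))) := by
        constructor
        · intro i
          simp [norm_smul, h0]
        · intro i j hij
          exact absurd (Subsingleton.elim i j) hij
      obtain ⟨b, hb⟩ := hv.exists_orthonormalBasis_extension_of_card_eq (by simp)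
      refine ⟨b, ?_⟩
      rw [hb 0 rfl, smul_smul, mul_inv_cancel₀ (norm_ne_zero_iff.2 h0), one_smul]
  have hinner : ∀ x, inner ℝ x ξ = b.repr x 0 * ‖ξ‖ := fun x => by
    conv_lhs => rw [hb]
    rw [inner_smul_right, b.repr_apply_apply, real_inner_comm, mul_comm]
  have h := norm_integral_ball_coord_le n ‖ξ‖
  rw [← b.measurePreserving_repr.setIntegral_preimage_emb
    b.repr.toHomeomorph.measurableEmbedding] at h
  have hpre : b.repr ⁻¹' closedBall 0 1 = closedBall 0 1 := by
    ext x; simp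
  rw [hpre] at h
  simpa only [hinner] using h

/-! ### Comparison of the ball and sphere multipliers -/

theorem sphereMultiplier_eq (d : ℕ) (ξ : EuclideanSpace ℝ (Fin d)) :
    sphereMultiplier d ξ = (1 / ((surfaceMeasure d).real univ : ℂ)) *
      ∫ x : sphere (0 : EuclideanSpace ℝ (Fin d)) 1,
        character (inner ℝ (x : EuclideanSpace ℝ (Fin d)) ξ) ∂(surfaceMeasure d) := rfl

theorem ballMultiplier_eq (d : ℕ) (ξ : EuclideanSpace ℝ (Fin d)) :
    ballMultiplier d ξ = (1 / (volume.real (closedBall (0 : EuclideanSpace ℝ (Fin d)) 1) : ℂ)) *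
      ∫ x in closedBall (0 : EuclideanSpace ℝ (Fin d)) 1, character (inner ℝ x ξ) := rfl

theorem surfaceMeasure_real_univ (d : ℕ) : (surfaceMeasure d).real univ =
    d * volume.real (closedBall (0 : EuclideanSpace ℝ (Fin d)) 1) := by
  rw [surfaceMeasure, Measure.toSphere_real_apply_univ, finrank_euclideanSpace_fin,
    measureReal_def, measureReal_def, Measure.addHaar_unitClosedBall_eq_addHaar_unitBall]

theorem volume_real_closedBall_pos (d : ℕ) :
    0 < volume.real (closedBall (0 : EuclideanSpace ℝ (Fin d)) 1) :=
  ENNReal.toReal_pos (measure_closedBall_pos _ _ one_pos).ne' measure_closedBall_lt_top.ne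

instance (d : ℕ) : IsFiniteMeasure (surfaceMeasure d) := by
  unfold surfaceMeasure; infer_instance

theorem surfaceMeasure_real_univ_pos {d : ℕ} (hd : 1 ≤ d) : 0 < (surfaceMeasure d).real univ := by
  rw [surfaceMeasure_real_univ]
  exact mul_pos (by exact_mod_cast hd) (volume_real_closedBall_pos d)

theorem integrable_character_inner (d : ℕ) (ξ : EuclideanSpace ℝ (Fin d)) :
    Integrable (fun x : sphere (0 : EuclideanSpace ℝ (Fin d)) 1 =>
      character (inner ℝ (x : EuclideanSpace ℝ (Fin d)) ξ)) (surfaceMeasure d) := by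
  refine Integrable.of_bound (C := 1) ?_ (.of_forall fun x => (norm_character _).le)
  have := continuous_character
  exact Continuous.aestronglyMeasurable (by fun_prop)

theorem norm_sphereMultiplier_le {d : ℕ} (hd : 1 ≤ d) (ξ : EuclideanSpace ℝ (Fin d)) :
    ‖sphereMultiplier d ξ‖ ≤ 1 := by
  have hp := surfaceMeasure_real_univ_pos hd
  have h : ‖∫ x : sphere (0 : EuclideanSpace ℝ (Fin d)) 1,
      character (inner ℝ (x : EuclideanSpace ℝ (Fin d)) ξ) ∂(surfaceMeasure d)‖ ≤
      1 * (surfaceMeasure d).real univ :=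
    norm_integral_le_of_norm_le_const (.of_forall fun x => (norm_character _).le)
  rw [sphereMultiplier_eq, norm_mul, norm_div, norm_one, Complex.norm_real, Real.norm_of_nonneg hp.le]
  rw [one_mul] at h
  rw [one_div_mul_eq_div]
  exact (div_le_one hp).2 h

/-- The divergence theorem for `x ↦ character (inner ℝ x ξ) • x`, proved ray by ray: the polar
integrand is the derivative of `r ^ d * character (r * s)`, which vanishes at `r = 0` because `d ≥
1`. -/
theorem integral_ball_add_eq_integral_sphere {d : ℕ} (hd : 1 ≤ d)
    (ξ : EuclideanSpace ℝ (Fin d)) :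
    (d : ℂ) * (∫ x in closedBall (0 : EuclideanSpace ℝ (Fin d)) 1, character (inner ℝ x ξ)) +
      (∫ x in closedBall (0 : EuclideanSpace ℝ (Fin d)) 1,
        (-2 * Real.pi * Complex.I * (inner ℝ x ξ : ℝ)) * character (inner ℝ x ξ)) =
    ∫ x : sphere (0 : EuclideanSpace ℝ (Fin d)) 1,
      character (inner ℝ (x : EuclideanSpace ℝ (Fin d)) ξ) ∂(surfaceMeasure d) := by
  have hnt : Nontrivial (EuclideanSpace ℝ (Fin d)) :=
    Module.nontrivial_of_finrank_pos (R := ℝ) (by rw [finrank_euclideanSpace_fin]; omega)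
  have hcc := continuous_character
  set B := closedBall (0 : EuclideanSpace ℝ (Fin d)) 1 with hB
  have hBm : MeasurableSet B := isClosed_closedBall.measurableSet
  have hBc : IsCompact B := isCompact_closedBall 0 1
  have hc1 : Continuous fun x : EuclideanSpace ℝ (Fin d) => (d : ℂ) * character (inner ℝ x ξ) := by
    fun_prop
  have hc2 : Continuous fun x : EuclideanSpace ℝ (Fin d) =>
      (-2 * Real.pi * Complex.I * (inner ℝ x ξ : ℝ)) * character (inner ℝ x ξ) := by fun_prop
  have hi1 := hc1.continuousOn.integrableOn_compact (μ := volume) hBc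
  have hi2 := hc2.continuousOn.integrableOn_compact (μ := volume) hBc
  have hi : IntegrableOn (fun x : EuclideanSpace ℝ (Fin d) => (d : ℂ) * character (inner ℝ x ξ) +
      (-2 * Real.pi * Complex.I * (inner ℝ x ξ : ℝ)) * character (inner ℝ x ξ)) B := hi1.add hi2
  rw [← integral_const_mul, ← integral_add hi1 hi2, ← integral_indicator hBm,
    integral_eq_integral_sphere_integral_Ioi _ ((integrable_indicator_iff hBm).2 hi),
    finrank_euclideanSpace_fin]
  change _ = ∫ x : sphere (0 : EuclideanSpace ℝ (Fin d)) 1, _ ∂(volume.toSphere)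
  congr 1
  ext θ
  have hθ : ‖(θ : EuclideanSpace ℝ (Fin d))‖ = 1 := by simp
  set s := inner ℝ (θ : EuclideanSpace ℝ (Fin d)) ξ with hs
  set G' : ℝ → ℂ := fun r => ((r ^ (d - 1) : ℝ) : ℂ) * (d * character (r * s) +
    (-2 * Real.pi * Complex.I * (r * s : ℝ)) * character (r * s)) with hG'
  have hG : ∀ r : ℝ, HasDerivAt (fun r : ℝ => ((r ^ d : ℝ) : ℂ) * character (r * s)) (G' r) r := by
    intro r
    convert! (hasDerivAt_pow d r).ofReal_comp.mul (hasDerivAt_character_mul s r) using 1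
    obtain ⟨n, rfl⟩ : ∃ n, d = n + 1 := ⟨d - 1, by omega⟩
    simp only [hG', Nat.add_sub_cancel]
    push_cast; ring
  have hG'c : Continuous G' := by fun_prop
  have hftc := intervalIntegral.integral_eq_sub_of_hasDerivAt (a := 0) (b := 1)
    (fun t _ => hG t) (hG'c.intervalIntegrable _ _)
  have h01 : ∫ r in (0 : ℝ)..1, G' r = character s := by
    rw [hftc]
    have : d ≠ 0 := by omega
    simp [this]
  rw [← h01, intervalIntegral.integral_of_le zero_le_one, ← integral_indicator measurableSet_Ioi,
    ← integral_indicator measurableSet_Ioc]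
  congr 1
  ext r
  by_cases hr : 0 < r
  · rw [indicator_of_mem (mem_Ioi.2 hr)]
    have hmem : r • (θ : EuclideanSpace ℝ (Fin d)) ∈ B ↔ r ∈ Ioc (0 : ℝ) 1 := by
      rw [hB, mem_closedBall_zero_iff, norm_smul, hθ, mul_one, Real.norm_of_nonneg hr.le]
      exact ⟨fun h => ⟨hr, h⟩, fun h => h.2⟩
    by_cases h : r ∈ Ioc (0 : ℝ) 1
    · rw [indicator_of_mem h, indicator_of_mem (hmem.2 h)]
      simp only [real_inner_smul_left, ← hs, hG', Complex.real_smul]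
    · rw [indicator_of_notMem h, indicator_of_notMem (fun h' => h (hmem.1 h')), smul_zero]
  · rw [indicator_of_notMem (by simpa using hr), indicator_of_notMem (fun h => hr h.1)]

theorem norm_ballMultiplier_sub_sphereMultiplier_le {d : ℕ} (hd : 1 ≤ d)
    (ξ : EuclideanSpace ℝ (Fin d)) : ‖ballMultiplier d ξ - sphereMultiplier d ξ‖ ≤ 2 / d := by
  have hv := volume_real_closedBall_pos d
  have hd0 : (0 : ℝ) < d := by exact_mod_cast hd
  have hT := norm_integral_ball_le hd ξ
  rw [ballMultiplier_eq, sphereMultiplier_eq, ← integral_ball_add_eq_integral_sphere hd,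
    surfaceMeasure_real_univ]
  set v := volume.real (closedBall (0 : EuclideanSpace ℝ (Fin d)) 1)
  set T := ∫ x in closedBall (0 : EuclideanSpace ℝ (Fin d)) 1,
        (-2 * Real.pi * Complex.I * (inner ℝ x ξ : ℝ)) * character (inner ℝ x ξ)
  set M := ∫ x in closedBall (0 : EuclideanSpace ℝ (Fin d)) 1, character (inner ℝ x ξ)
  have hvC : (v : ℂ) ≠ 0 := by exact_mod_cast hv.ne'
  have hdC : (d : ℂ) ≠ 0 := by exact_mod_cast hd0.ne'
  have : 1 / (v : ℂ) * M - 1 / ((d * v : ℝ) : ℂ) * (d * M + T) = -T / ((d * v : ℝ) : ℂ) := by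
    push_cast; field_simp; ring
  rw [this, norm_div, norm_neg, Complex.norm_real, Real.norm_of_nonneg (by positivity),
    div_le_div_iff₀ (by positivity) hd0]
  nlinarith

/-! ### Variation of the multipliers under dilation -/

theorem hasDerivAt_integral_ball_character (d : ℕ) (ξ : EuclideanSpace ℝ (Fin d)) (r : ℝ) :
    HasDerivAt (fun r : ℝ => ∫ x in closedBall (0 : EuclideanSpace ℝ (Fin d)) 1,
        character (r * inner ℝ x ξ))
      (∫ x in closedBall (0 : EuclideanSpace ℝ (Fin d)) 1,
        -2 * Real.pi * Complex.I * (inner ℝ x ξ : ℝ) * character (r * inner ℝ x ξ)) r := by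
  have hcc := continuous_character
  have hfin : IsFiniteMeasure (volume.restrict (closedBall (0 : EuclideanSpace ℝ (Fin d)) 1)) :=
    ⟨by simpa using measure_closedBall_lt_top⟩
  refine (hasDerivAt_integral_of_dominated_loc_of_deriv_le (s := univ)
    (bound := fun _ => 2 * Real.pi * ‖ξ‖) Filter.univ_mem
    (.of_forall fun r => Continuous.aestronglyMeasurable (by fun_prop)) ?_
    (Continuous.aestronglyMeasurable (by fun_prop)) ?_ (integrable_const _)
    (.of_forall fun x t _ => hasDerivAt_character_mul _ t)).2
  · exact Integrable.of_bound (C := 1) (Continuous.aestronglyMeasurable (by fun_prop))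
      (.of_forall fun x => (norm_character _).le)
  · filter_upwards [ae_restrict_mem isClosed_closedBall.measurableSet] with x hx t _
    have hx1 : ‖x‖ ≤ 1 := by simpa using hx
    have h1 : |inner ℝ x ξ| ≤ ‖ξ‖ :=
      (abs_real_inner_le_norm x ξ).trans (mul_le_of_le_one_left (norm_nonneg _) hx1)
    simp only [norm_mul, norm_neg, Complex.norm_I, Complex.norm_real, norm_character, mul_one,
      RCLike.norm_ofNat, Real.norm_of_nonneg Real.pi_pos.le, Real.norm_eq_abs]
    gcongr

/-- Mean value inequality: `t` times the derivative at `t` is the integral of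
`norm_integral_ball_le` at `t • ξ`, divided by the volume. The derivative is thus at most `2 / t`,
which is at most `4` for `t ≥ 1/2`. -/
theorem norm_ballMultiplier_smul_sub_le {d : ℕ} (hd : 1 ≤ d) (ξ : EuclideanSpace ℝ (Fin d))
    {r : ℝ} (hr : 1 / 2 ≤ r) :
    ‖ballMultiplier d (r • ξ) - ballMultiplier d ξ‖ ≤ 4 * |r - 1| := by
  have hv := volume_real_closedBall_pos d
  set A : ℝ → ℂ := fun r => ∫ x in closedBall (0 : EuclideanSpace ℝ (Fin d)) 1,
        character (r * inner ℝ x ξ) with hA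
  have hm : ∀ r : ℝ, ballMultiplier d (r • ξ) =
      (1 / (volume.real (closedBall (0 : EuclideanSpace ℝ (Fin d)) 1) : ℂ)) * A r := fun r => by
    simp only [ballMultiplier_eq, hA, inner_smul_right]
  set v := volume.real (closedBall (0 : EuclideanSpace ℝ (Fin d)) 1)
  have hbound : ∀ t ∈ Ici (1 / 2 : ℝ), ‖∫ x in closedBall (0 : EuclideanSpace ℝ (Fin d)) 1,
        -2 * Real.pi * Complex.I * (inner ℝ x ξ : ℝ) * character (t * inner ℝ x ξ)‖ ≤ 4 * v := by
    intro t ht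
    have ht' : (1 / 2 : ℝ) ≤ t := ht
    have h := norm_integral_ball_le hd (t • ξ)
    have : ∀ x : EuclideanSpace ℝ (Fin d),
        (-2 * Real.pi * Complex.I * (inner ℝ x (t • ξ) : ℝ)) * character (inner ℝ x (t • ξ)) =
        t * (-2 * Real.pi * Complex.I * (inner ℝ x ξ : ℝ) * character (t * inner ℝ x ξ)) := by
      intro x; rw [inner_smul_right]; push_cast; ring
    simp only [this] at h
    rw [integral_const_mul, norm_mul, Complex.norm_real, Real.norm_of_nonneg (by linarith)] at h
    set N := ‖∫ x in closedBall (0 : EuclideanSpace ℝ (Fin d)) 1,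
        -2 * Real.pi * Complex.I * (inner ℝ x ξ : ℝ) * character (t * inner ℝ x ξ)‖
    have hN : 0 ≤ N := norm_nonneg _
    nlinarith
  have h := (convex_Ici (1 / 2 : ℝ)).norm_image_sub_le_of_norm_hasDerivWithin_le
    (fun t _ => (hasDerivAt_integral_ball_character d ξ t).hasDerivWithinAt) hbound
    (mem_Ici.2 (by norm_num : (1 / 2 : ℝ) ≤ 1)) (mem_Ici.2 hr)
  have h1 := hm 1
  rw [one_smul] at h1
  rw [hm, h1, ← mul_sub, norm_mul, norm_div, norm_one, Complex.norm_real, Real.norm_of_nonneg hv.le,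
    one_div_mul_eq_div, div_le_iff₀ hv]
  calc _ ≤ _ := h
    _ = _ := by rw [Real.norm_eq_abs]; ring

/-- For `r ≥ 1/2`, passing to the ball multiplier and back costs `2 / d` twice. For `r < 1/2` the
trivial bound `2` is enough, since `4 * (1 - r ^ 2) > 3`. The form `|r ^ 2 - 1|` suits the explicit
Gaussian moments. -/
theorem norm_sphereMultiplier_smul_sub_le {d : ℕ} (hd : 1 ≤ d) (ξ : EuclideanSpace ℝ (Fin d))
    {r : ℝ} (hr : 0 ≤ r) :
    ‖sphereMultiplier d (r • ξ) - sphereMultiplier d ξ‖ ≤ 4 / d + 4 * |r ^ 2 - 1| := by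
  have hd0 : (0 : ℝ) < d := by exact_mod_cast hd
  rcases le_or_gt (1 / 2) r with h | h
  · have h1 := norm_ballMultiplier_sub_sphereMultiplier_le hd (r • ξ)
    have h2 := norm_ballMultiplier_sub_sphereMultiplier_le hd ξ
    have h3 := norm_ballMultiplier_smul_sub_le hd ξ h
    have h4 : |r - 1| ≤ |r ^ 2 - 1| := by
      rw [show r ^ 2 - 1 = (r - 1) * (r + 1) by ring, abs_mul, abs_of_nonneg (by linarith : 0 ≤ r + 1)]
      nlinarith [abs_nonneg (r - 1)]
    have h5 : sphereMultiplier d (r • ξ) - sphereMultiplier d ξ =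
        (ballMultiplier d (r • ξ) - ballMultiplier d ξ) -
        (ballMultiplier d (r • ξ) - sphereMultiplier d (r • ξ)) +
        (ballMultiplier d ξ - sphereMultiplier d ξ) := by ring
    have h6 : (4 : ℝ) / d = 2 / d + 2 / d := by ring
    rw [h5, h6]
    refine (norm_add_le _ _).trans ?_
    have := norm_sub_le (ballMultiplier d (r • ξ) - ballMultiplier d ξ)
      (ballMultiplier d (r • ξ) - sphereMultiplier d (r • ξ))
    linarith
  · have h1 := norm_sub_le (sphereMultiplier d (r • ξ)) (sphereMultiplier d ξ)
    have h2 := norm_sphereMultiplier_le hd (r • ξ)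
    have h3 := norm_sphereMultiplier_le hd ξ
    have h4 : 0 ≤ (4 : ℝ) / d := by positivity
    have h5 : 1 - r ^ 2 ≤ |r ^ 2 - 1| := by rw [abs_sub_comm]; exact le_abs_self _
    nlinarith

/-! ### Moments of the Gaussian radial law -/

theorem integrableOn_pow_mul_exp_neg_mul_sq {b : ℝ} (hb : 0 < b) (n : ℕ) :
    IntegrableOn (fun r : ℝ => r ^ n * Real.exp (-b * r ^ 2)) (Ioi 0) := by
  have := integrableOn_rpow_mul_exp_neg_mul_sq hb (s := n) (by have := n.cast_nonneg (α := ℝ); linarith)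
  simpa only [Real.rpow_natCast] using this

theorem integral_pow_add_two_mul_exp_neg_mul_sq {b : ℝ} (hb : 0 < b) (n : ℕ) :
    ∫ r in Ioi (0 : ℝ), r ^ (n + 2) * Real.exp (-b * r ^ 2) =
      (n + 1) / (2 * b) * ∫ r in Ioi (0 : ℝ), r ^ n * Real.exp (-b * r ^ 2) := by
  have hn := n.cast_nonneg (α := ℝ)
  have h1 := integral_rpow_mul_exp_neg_mul_rpow (p := 2) (q := n) two_pos (by linarith) hb
  have h2 := integral_rpow_mul_exp_neg_mul_rpow (p := 2) (q := (n + 2 : ℕ)) two_pos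
    (by push_cast; linarith) hb
  simp only [Real.rpow_natCast, Real.rpow_two] at h1 h2
  rw [h1, h2]
  have h3 : (((n + 2 : ℕ) : ℝ) + 1) / 2 = ((n : ℝ) + 1) / 2 + 1 := by push_cast; ring
  have h4 : -(((n + 2 : ℕ) : ℝ) + 1) / 2 = -((n : ℝ) + 1) / 2 - 1 := by push_cast; ring
  rw [h3, h4, Real.Gamma_add_one (by positivity), Real.rpow_sub_one hb.ne']
  field_simp

/-- The unnormalized law of `|X|` for a centred Gaussian vector `X` in `ℝ^d` with `E|X|² = 1`. -/
noncomputable def radialWeight (d : ℕ) (r : ℝ) : ℝ := r ^ (d - 1) * Real.exp (-(d / 2) * r ^ 2)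

theorem integrableOn_radialWeight {d : ℕ} (hd : 1 ≤ d) : IntegrableOn (radialWeight d) (Ioi 0) :=
  integrableOn_pow_mul_exp_neg_mul_sq (by have : (1 : ℝ) ≤ d := by exact_mod_cast hd
                                          linarith) _

theorem integral_radialWeight_pos {d : ℕ} (hd : 1 ≤ d) : 0 < ∫ r in Ioi 0, radialWeight d r := by
  have hpos : ∀ r ∈ Ioi (0 : ℝ), 0 < radialWeight d r := fun r hr =>
    mul_pos (pow_pos hr _) (Real.exp_pos _)
  rw [setIntegral_pos_iff_support_of_nonneg_ae
    ((ae_restrict_mem measurableSet_Ioi).mono fun r hr => (hpos r hr).le)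
    (integrableOn_radialWeight hd)]
  have : Function.support (radialWeight d) ∩ Ioi 0 = Ioi 0 :=
    inter_eq_right.2 fun r hr => (hpos r hr).ne'
  rw [this]; simp

theorem integrableOn_variance_radialWeight {d : ℕ} (hd : 1 ≤ d) :
    IntegrableOn (fun r => radialWeight d r * (r ^ 2 - 1) ^ 2) (Ioi 0) := by
  have hd0 : (1 : ℝ) ≤ d := by exact_mod_cast hd
  have hb : (0 : ℝ) < d / 2 := by linarith
  have h4 := integrableOn_pow_mul_exp_neg_mul_sq hb (d - 1 + 2 + 2)
  have h2 := (integrableOn_pow_mul_exp_neg_mul_sq hb (d - 1 + 2)).const_mul 2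
  have h0 := integrableOn_pow_mul_exp_neg_mul_sq hb (d - 1)
  refine ((h4.sub h2).add h0).congr (.of_forall fun r => ?_)
  simp only [radialWeight, Pi.add_apply, Pi.sub_apply]; ring

/-- After normalization the moments of `r ^ 2` and `r ^ 4` are `1` and `(d + 2) / d`, so the
variance of `r ^ 2` is `2 / d`. -/
theorem integral_variance_radialWeight {d : ℕ} (hd : 1 ≤ d) :
    ∫ r in Ioi 0, radialWeight d r * (r ^ 2 - 1) ^ 2 = 2 / d * ∫ r in Ioi 0, radialWeight d r := by
  have hd0 : (1 : ℝ) ≤ d := by exact_mod_cast hd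
  have hb : (0 : ℝ) < d / 2 := by linarith
  have h4 := integrableOn_pow_mul_exp_neg_mul_sq hb (d - 1 + 2 + 2)
  have h2 := (integrableOn_pow_mul_exp_neg_mul_sq hb (d - 1 + 2)).const_mul 2
  have h0 := integrableOn_pow_mul_exp_neg_mul_sq hb (d - 1)
  have : ∀ r, radialWeight d r * (r ^ 2 - 1) ^ 2 =
      r ^ (d - 1 + 2 + 2) * Real.exp (-(d / 2) * r ^ 2) -
      2 * (r ^ (d - 1 + 2) * Real.exp (-(d / 2) * r ^ 2)) +
      r ^ (d - 1) * Real.exp (-(d / 2) * r ^ 2) := fun r => by simp only [radialWeight]; ring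
  simp only [this]
  have h42 : IntegrableOn (fun r : ℝ => r ^ (d - 1 + 2 + 2) * Real.exp (-(d / 2) * r ^ 2) -
      2 * (r ^ (d - 1 + 2) * Real.exp (-(d / 2) * r ^ 2))) (Ioi 0) := h4.sub h2
  rw [integral_add h42 h0, integral_sub h4 h2, integral_const_mul,
    integral_pow_add_two_mul_exp_neg_mul_sq hb, integral_pow_add_two_mul_exp_neg_mul_sq hb]
  change _ = 2 / (d : ℝ) * ∫ r in Ioi (0 : ℝ), r ^ (d - 1) * Real.exp (-(d / 2) * r ^ 2)
  push_cast [Nat.cast_sub hd]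
  field_simp
  ring

/-! ### The Gaussian multiplier as a radial average of sphere multipliers -/

theorem sphereMultiplier_zero {d : ℕ} (hd : 1 ≤ d) : sphereMultiplier d 0 = 1 := by
  have := (surfaceMeasure_real_univ_pos hd).ne'
  rw [sphereMultiplier_eq]
  simp [character, this]

theorem continuous_sphereMultiplier_smul (d : ℕ) (ξ : EuclideanSpace ℝ (Fin d)) :
    Continuous fun r : ℝ => sphereMultiplier d (r • ξ) := by
  have hc := continuous_character
  simp only [sphereMultiplier_eq]
  refine continuous_const.mul (continuous_of_dominated (bound := fun _ => 1) ?_ ?_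
    (integrable_const _) ?_)
  · exact fun r => (integrable_character_inner d (r • ξ)).aestronglyMeasurable
  · exact fun r => .of_forall fun x => (norm_character _).le
  · exact .of_forall fun x => by fun_prop

theorem integral_gaussian_mul_character {d : ℕ} (hd : 1 ≤ d) (ξ : EuclideanSpace ℝ (Fin d)) :
    ∫ v : EuclideanSpace ℝ (Fin d), Complex.exp (-((d / 2 : ℝ) : ℂ) * ‖v‖ ^ 2 +
      (-2 * Real.pi * Complex.I) * (inner ℝ ξ v : ℝ)) =
    (surfaceMeasure d).real univ * ∫ r in Ioi 0, (radialWeight d r : ℂ) *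
      sphereMultiplier d (r • ξ) := by
  have hnt : Nontrivial (EuclideanSpace ℝ (Fin d)) :=
    Module.nontrivial_of_finrank_pos (R := ℝ) (by rw [finrank_euclideanSpace_fin]; omega)
  have hd0 : (1 : ℝ) ≤ d := by exact_mod_cast hd
  have hS := (surfaceMeasure_real_univ_pos hd).ne'
  rw [integral_eq_integral_Ioi_integral_sphere _ (GaussianFourier.integrable_cexp_neg_mul_sq_norm_add
    (by rw [Complex.ofReal_re]; linarith) _ ξ), finrank_euclideanSpace_fin, ← integral_const_mul]
  refine setIntegral_congr_fun measurableSet_Ioi fun r hr => ?_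
  have hr0 : (0 : ℝ) < r := hr
  have hSC : ((surfaceMeasure d).real univ : ℂ) ≠ 0 := by exact_mod_cast hS
  have : ∀ θ : sphere (0 : EuclideanSpace ℝ (Fin d)) 1,
      Complex.exp (-((d / 2 : ℝ) : ℂ) * ‖r • (θ : EuclideanSpace ℝ (Fin d))‖ ^ 2 +
        (-2 * Real.pi * Complex.I) * (inner ℝ ξ (r • (θ : EuclideanSpace ℝ (Fin d))) : ℝ)) =
      (Real.exp (-(d / 2) * r ^ 2) : ℂ) *
        character (inner ℝ (θ : EuclideanSpace ℝ (Fin d)) (r • ξ)) := by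
    intro θ
    have hθ : ‖(θ : EuclideanSpace ℝ (Fin d))‖ = 1 := by simp
    rw [norm_smul, hθ, mul_one, Real.norm_of_nonneg hr0.le, Complex.exp_add, character,
      inner_smul_right, inner_smul_right, real_inner_comm]
    push_cast; rfl
  simp only [this]
  rw [integral_const_mul, sphereMultiplier_eq, radialWeight]
  change _ • (_ * ∫ x : sphere (0 : EuclideanSpace ℝ (Fin d)) 1, _ ∂(surfaceMeasure d)) = _
  rw [Complex.real_smul]
  push_cast
  field_simp

theorem gaussMultiplier_mul_integral_radialWeight {d : ℕ} (hd : 1 ≤ d)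
    (ξ : EuclideanSpace ℝ (Fin d)) :
    (gaussMultiplier d ξ : ℂ) * ((∫ r in Ioi 0, radialWeight d r : ℝ) : ℂ) =
      ∫ r in Ioi 0, (radialWeight d r : ℂ) * sphereMultiplier d (r • ξ) := by
  have hd0 : (1 : ℝ) ≤ d := by exact_mod_cast hd
  have hdC : (d : ℂ) ≠ 0 := by exact_mod_cast (by linarith : (d : ℝ) ≠ 0)
  have hb : 0 < ((d / 2 : ℝ) : ℂ).re := by rw [Complex.ofReal_re]; linarith
  have hSC : ((surfaceMeasure d).real univ : ℂ) ≠ 0 := by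
    exact_mod_cast (surfaceMeasure_real_univ_pos hd).ne'
  have h1 := integral_gaussian_mul_character hd ξ
  -- The case `ξ = 0` identifies the normalizing constant, so its explicit value is never needed.
  have h0 := integral_gaussian_mul_character hd (0 : EuclideanSpace ℝ (Fin d))
  rw [GaussianFourier.integral_cexp_neg_mul_sq_norm_add hb] at h0 h1
  simp only [smul_zero, sphereMultiplier_zero hd, mul_one, norm_zero] at h0
  rw [integral_complex_ofReal] at h0
  apply mul_left_cancel₀ hSC
  rw [← h1, mul_left_comm, ← h0, gaussMultiplier, mul_comm]
  have : (-2 * (Real.pi : ℂ) * Complex.I) ^ 2 * (‖ξ‖ : ℂ) ^ 2 / (4 * ((d / 2 : ℝ) : ℂ)) =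
      ((-(2 * Real.pi ^ 2 * ‖ξ‖ ^ 2 / d) : ℝ) : ℂ) := by
    push_cast
    rw [mul_pow, mul_pow, Complex.I_sq]
    field_simp
    ring
  rw [this]
  simp

theorem norm_gaussMultiplier_sub_sphereMultiplier_le {d : ℕ} (hd : 1 ≤ d)
    (ξ : EuclideanSpace ℝ (Fin d)) :
    ‖(gaussMultiplier d ξ : ℂ) - sphereMultiplier d ξ‖ ≤ 10 / Real.sqrt d := by
  have hd1 : (1 : ℝ) ≤ d := by exact_mod_cast hd
  have hZ := integral_radialWeight_pos hd
  have hwi := integrableOn_radialWeight hd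
  have hvi := integrableOn_variance_radialWeight hd
  set s := Real.sqrt d with hs
  have hs1 : 1 ≤ s := Real.one_le_sqrt.2 hd1
  have hs2 : s ^ 2 = d := Real.sq_sqrt (by linarith)
  set Z := ∫ r in Ioi 0, radialWeight d r with hZdef
  have hwC : IntegrableOn (fun r => (radialWeight d r : ℂ)) (Ioi 0) := hwi.ofReal
  have hwμ : IntegrableOn (fun r => (radialWeight d r : ℂ) * sphereMultiplier d (r • ξ)) (Ioi 0) := by
    refine hwC.mul_bdd (c := 1)
      (continuous_sphereMultiplier_smul d ξ).aestronglyMeasurable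
      (.of_forall fun r => norm_sphereMultiplier_le hd _)
  have hdiff : ((gaussMultiplier d ξ : ℂ) - sphereMultiplier d ξ) * Z =
      ∫ r in Ioi 0, (radialWeight d r : ℂ) *
        (sphereMultiplier d (r • ξ) - sphereMultiplier d ξ) := by
    simp only [mul_sub]
    rw [sub_mul, gaussMultiplier_mul_integral_radialWeight hd, integral_sub hwμ (hwC.mul_const _),
      integral_mul_const, integral_complex_ofReal, mul_comm (sphereMultiplier d ξ)]
  have hbound : ‖((gaussMultiplier d ξ : ℂ) - sphereMultiplier d ξ) * Z‖ ≤
      ∫ r in Ioi 0, ((4 / d + 2 / s) * radialWeight d r +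
        2 * s * (radialWeight d r * (r ^ 2 - 1) ^ 2)) := by
    rw [hdiff]
    refine norm_integral_le_of_norm_le ((hwi.const_mul _).add (hvi.const_mul _)) ?_
    filter_upwards [ae_restrict_mem measurableSet_Ioi] with r hr
    have hr0 : (0 : ℝ) < r := hr
    have hw : 0 ≤ radialWeight d r := mul_nonneg (pow_nonneg hr0.le _) (Real.exp_pos _).le
    rw [norm_mul, Complex.norm_real, Real.norm_of_nonneg hw]
    have h1 := norm_sphereMultiplier_smul_sub_le hd ξ hr0.le
    -- AM-GM with weight `s = √d`, balancing the two terms: the variance `2 / d` turns the second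
    -- into `4 / s`, for a total of `4 / d + 6 / s ≤ 10 / s`.
    have h2 : 4 * |r ^ 2 - 1| ≤ 2 / s + 2 * s * (r ^ 2 - 1) ^ 2 := by
      rw [← sq_abs (r ^ 2 - 1)]
      have h3 : 2 / s + 2 * s * |r ^ 2 - 1| ^ 2 - 4 * |r ^ 2 - 1| =
          2 / s * (s * |r ^ 2 - 1| - 1) ^ 2 := by field_simp; ring
      have : 0 ≤ 2 / s * (s * |r ^ 2 - 1| - 1) ^ 2 := by positivity
      linarith
    calc _ ≤ radialWeight d r * (4 / d + (2 / s + 2 * s * (r ^ 2 - 1) ^ 2)) := by gcongr; linarith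
      _ = _ := by ring
  rw [integral_add (hwi.const_mul _) (hvi.const_mul _), integral_const_mul, integral_const_mul,
    integral_variance_radialWeight hd, ← hZdef, norm_mul, Complex.norm_real,
    Real.norm_of_nonneg hZ.le] at hbound
  have h5 : (4 / d + 2 / s) * Z + 2 * s * (2 / d * Z) = (4 / d + 6 / s) * Z := by
    rw [← hs2]; field_simp; ring
  rw [h5] at hbound
  refine (le_of_mul_le_mul_right hbound hZ).trans ?_
  have h6 : (4 : ℝ) / d ≤ 4 / s := by
    rw [← hs2]; gcongr; nlinarith
  have h7 : (10 : ℝ) / s = 4 / s + 6 / s := by ring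
  linarith

end MaximalMultipliers

theorem proposition5p1 :
    (∃ C : ℝ, 0 < C ∧ ∀ d : ℕ, 3 ≤ d → ∀ ξ : EuclideanSpace ℝ (Fin d),
      ‖MaximalMultipliers.ballMultiplier d ξ - MaximalMultipliers.sphereMultiplier d ξ‖
        ≤ C * (d : ℝ) ^ (-1 : ℝ)) ∧
    (∀ α : ℝ, 0 < α → ∃ C : ℝ, 0 < C ∧ ∀ d : ℕ, 3 ≤ d → ∀ ξ : EuclideanSpace ℝ (Fin d),
      ‖(MaximalMultipliers.gaussMultiplier d ξ : ℂ) - MaximalMultipliers.sphereMultiplier d ξ‖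
        ≤ C * (d : ℝ) ^ (-1 / 4 + α : ℝ)) := by
  refine ⟨⟨2, two_pos, fun d hd ξ => ?_⟩, fun α hα => ⟨10, by norm_num, fun d hd ξ => ?_⟩⟩
  · rw [Real.rpow_neg_one, ← div_eq_mul_inv]
    exact MaximalMultipliers.norm_ballMultiplier_sub_sphereMultiplier_le (by omega) ξ
  · refine (MaximalMultipliers.norm_gaussMultiplier_sub_sphereMultiplier_le (by omega) ξ).trans ?_
    have hd1 : (1 : ℝ) ≤ d := by exact_mod_cast (by omega : 1 ≤ d)
    -- It remains to compare exponents: `-1/2 ≤ -1/4 + α`, with base `d ≥ 1`.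
    rw [div_eq_mul_inv, Real.sqrt_eq_rpow, ← Real.rpow_neg (by linarith)]
    gcongr
    linarith
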